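/- For $l\ge 0$ let $\mathcal P_l$ be the space of complex polynomials of degree at most $l$, with norm the Euclidean norm of the coefficient vector, and give product spaces the norm $\|(a,b)\|=\sqrt{\|a\|^2+\|b\|^2}$. For a linear map $A$ between finite-dimensional Hermitian spaces, $A_{\text{rank-}r}$ denotes the rank-$r$ map nearest to $A$ in the Frobenius norm, $A^\dagger$ the Moore–Penrose inverse, $\|A\|$ the operator norm, and $A_{\text{rank-}r}^\dagger=(A_{\text{rank-}r})^\dagger$. **Theorem 2 (Regularization of GCD).** There is an absolute constant $c>0$ such that the following holds. Let $p,q\in\mathbb C[x]$ have degrees $m$ and $n$ (so both are nonzero) and let their greatest common divisor have degree $k$. Put $r=m+n-k+2$ and $$\mathbf f:\ \mathcal P_k\times\mathcal P_{m-k}\times\mathcal P_{n-k}\times\mathcal P_m\times\mathcal P_n\to\mathcal P_m\times\mathcal P_n,\qquad \mathbf f(u,v,w,f,g)=(uv-f,\ uw-g),$$ with $\mathbf f_{uvw}$ its Jacobian with respect to $(u,v,w)$. Let $(\hat u,\hat v,\hat w)$ be any zero of $(u,v,w)\mapsto\mathbf f(u,v,w,p,q)$. Then there are $\delta,\varepsilon>0$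 and constants $C,K$ such that for all data $(\tilde p,\tilde q)\in\mathcal P_m\times\mathcal P_n$ with $\|(\tilde p,\tilde q)-(p,q)\|<\delta$ and all initial iterates with $\|(u_0,v_0,w_0)-(\hat u,\hat v,\hat w)\|<\varepsilon$: 1. the rank-$r$ Newton iteration $$(u_{j+1},v_{j+1},w_{j+1})=(u_j,v_j,w_j)-\mathbf f_{uvw}(u_j,v_j,w_j,\tilde p,\tilde q)_{\text{rank-}r}^\dagger\,\mathbf f(u_j,v_j,w_j,\tilde p,\tilde q),\quad j=0,1,\dots$$ is well defined (the rank-$r$ projection of the Jacobian at each iterate exists and is unique) and converges to some $(\tilde u,\tilde v,\tilde w)$; 2. there is an exact GCD triple $(\check u,\check v,\check w)$ of $(p,q)$, that is, $\check u\check v=p$, $\check u\check w=q$ and $\check u$ is a nonzero constant multiple of $\gcd(p,q)$, with $$\|(\tilde u,\tilde v,\tilde w)-(\check u,\check v,\check w)\|\le c\,\big\|\mathbf f_{uvw}(\hat u,\hat v,\hat w,p,q)_{\text{rank-}r}^\dagger\big\|\,\|(\tilde p,\tilde q)-(p,q)\|+C\,\|(\tilde p,\tilde q)-(p,q)\|^2;$$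 3. if $(\tilde p,\tilde q)=(p,q)$, the convergence is quadratic: for all $j\ge 0$, $$\|(u_{j+1},v_{j+1},w_{j+1})-(\tilde u,\tilde v,\tilde w)\|\le K\,\|(u_j,v_j,w_j)-(\tilde u,\tilde v,\tilde w)\|^2 .$$ The factor $\big\|\mathbf f_{uvw}(\hat u,\hat v,\hat w,p,q)_{\text{rank-}r}^\dagger\big\|$ is called the GCD condition number. -/

import Mathlib

open Filter Topology Polynomial

noncomputable section

namespace GCDReg

/-! ### Low-rank projections and Moore–Penrose inverses of linear maps -/

section LinearMaps

variable {V W : Type*}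
  [NormedAddCommGroup V] [InnerProductSpace ℂ V] [FiniteDimensional ℂ V]
  [NormedAddCommGroup W] [InnerProductSpace ℂ W] [FiniteDimensional ℂ W]

/-- The Frobenius norm of a linear map: the square root of the sum of the squared norms of the
columns of its matrix in an orthonormal basis of the domain (it is independent of the basis). -/
def frobNorm (A : V →L[ℂ] W) : ℝ :=
  Real.sqrt (∑ i, ‖A (stdOrthonormalBasis ℂ V i)‖ ^ 2)

/-- The rank of a linear map between finite-dimensional spaces. -/
def rk (A : V →L[ℂ] W) : ℕ :=
  Module.finrank ℂ (LinearMap.range (A : V →ₗ[ℂ] W))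

/-- `B` is a rank-`r` projection of `A`: a map of rank `r` with the smallest Frobenius distance
to `A` among all maps of rank `r`. -/
def IsRankProj (r : ℕ) (A B : V →L[ℂ] W) : Prop :=
  rk B = r ∧ ∀ C : V →L[ℂ] W, rk C = r → frobNorm (B - A) ≤ frobNorm (C - A)

open Classical in
/-- The rank-`r` projection of `A`, with the value `0` if there is none. If there are several,
one of them is chosen. -/
def rankProj (r : ℕ) (A : V →L[ℂ] W) : V →L[ℂ] W :=
  if h : ∃ B, IsRankProj r A B then h.choose else 0

/-- The Moore–Penrose inverse: project orthogonally onto the range of `A`, then apply the inverse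
of the bijection from `(ker A)ᗮ` onto the range of `A` that is induced by `A`. -/
def pinv (A : V →L[ℂ] W) : W →L[ℂ] V :=
  LinearMap.toContinuousLinearMap
    ((LinearMap.ker (A : V →ₗ[ℂ] W))ᗮ.subtype ∘ₗ
      ((A : V →ₗ[ℂ] W).kerComplementEquivRange
        (Submodule.isCompl_orthogonal (LinearMap.ker (A : V →ₗ[ℂ] W))).symm).symm.toLinearMap ∘ₗ
      ((LinearMap.range (A : V →ₗ[ℂ] W)).orthogonalProjectionOnto : W →ₗ[ℂ] _))

/-- One step of the rank-`r` Newton iteration for the mapping `f`. -/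
def newtonStep (r : ℕ) (f : V → W) (x : V) : V :=
  x - pinv (rankProj r (fderiv ℂ f x)) (f x)

/-- The `j`-th iterate of the rank-`r` Newton iteration for `f` from the initial iterate `x₀`. -/
def newtonIter (r : ℕ) (f : V → W) (x₀ : V) (j : ℕ) : V :=
  (newtonStep r f)^[j] x₀

end LinearMaps

/-! ### The GCD equation -/

/-- The space of polynomials of degree at most `l` over `ℂ`, given by the vector of the
coefficients of `1, X, …, X ^ l` with the Euclidean norm. -/
abbrev PolySpace (l : ℕ) : Type := EuclideanSpace ℂ (Fin (l + 1))

/-- The polynomial with a given coefficient vector. -/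
def toPoly {l : ℕ} (u : PolySpace l) : ℂ[X] :=
  ∑ i : Fin (l + 1), C (u i) * X ^ (i : ℕ)

/-- The vector of the coefficients of `1, X, …, X ^ l` of a polynomial. -/
def ofPoly (l : ℕ) (P : ℂ[X]) : PolySpace l :=
  WithLp.toLp 2 fun i : Fin (l + 1) => P.coeff (i : ℕ)

/-- The space of the triples `(u, v, w)` with `deg u ≤ k`, `deg v ≤ m - k`, `deg w ≤ n - k`,
with the norm `√(‖u‖² + ‖v‖² + ‖w‖²)`. -/
abbrev TripleSpace (m n k : ℕ) : Type :=
  WithLp 2 (PolySpace k × WithLp 2 (PolySpace (m - k) × PolySpace (n - k)))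

/-- The space of the pairs `(f, g)` with `deg f ≤ m`, `deg g ≤ n`, with the norm
`√(‖f‖² + ‖g‖²)`. -/
abbrev PairSpace (m n : ℕ) : Type := WithLp 2 (PolySpace m × PolySpace n)

/-- The mapping `(u, v, w, f, g) ↦ (u v - f, u w - g)`, used for `k ≤ m` and `k ≤ n`, where the
products have degrees at most `m` and `n`. -/
def gcdMap {m n k : ℕ} (x : TripleSpace m n k) (y : PairSpace m n) : PairSpace m n :=
  WithLp.toLp 2
    (ofPoly m (toPoly x.fst * toPoly x.snd.fst) - y.fst,
      ofPoly n (toPoly x.fst * toPoly x.snd.snd) - y.snd)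

/-- The Jacobian `f_{uvw}(u, v, w, f, g)` with respect to the triple `(u, v, w)`. -/
def gcdJac {m n k : ℕ} (x : TripleSpace m n k) (y : PairSpace m n) :
    TripleSpace m n k →L[ℂ] PairSpace m n :=
  fderiv ℂ (fun z : TripleSpace m n k => gcdMap z y) x

/-- `(u, v, w)` is an exact GCD triple of `(p, q)`: `u` is a nonzero constant multiple of the
greatest common divisor, and `v` and `w` are the cofactors, `p = u v` and `q = u w`. -/
def IsGCDTriple {m n k : ℕ} (x : TripleSpace m n k) (p q : ℂ[X]) : Prop :=
  Associated (toPoly x.fst) (EuclideanDomain.gcd p q) ∧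
    toPoly x.fst * toPoly x.snd.fst = p ∧ toPoly x.fst * toPoly x.snd.snd = q

/-- The GCD condition number at `y = (p, q)` and the zero `x = (u, v, w)`: the operator norm
of the Moore–Penrose inverse of the rank-`(m + n - k + 2)` projection of the Jacobian. -/
def gcdCond {m n k : ℕ} (x : TripleSpace m n k) (y : PairSpace m n) : ℝ :=
  ‖pinv (rankProj (m + n - k + 2) (gcdJac x y))‖

end GCDReg

end

open GCDReg

noncomputable section

namespace GCDReg

/-! ### Rank projections and least-squares estimates for the Moore–Penrose inverse. -/

section PseudoInverse

variable {V W : Type*}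
  [NormedAddCommGroup V] [InnerProductSpace ℂ V] [FiniteDimensional ℂ V]
  [NormedAddCommGroup W] [InnerProductSpace ℂ W]

/-! The GCD map is `½ J x x - y` with `J` symmetric bilinear, and `J x` is its Jacobian
(`gcdMap_eq_quadMap`). The isometric involution `E (u, v, w) = (u, -v, -w)` satisfies `J x (E x) =
0` at every `x`; it generates the scalings `(e^t u, e^{-t} v, e^{-t} w)`. At a zero `a` of the exact
equation the cofactors are coprime, so `ker (J a)` is exactly the line of `E a`. The domain has
dimension `r + 1`, so `J a` has rank `r`. The lower bound for `J a` off its kernel persists near `a`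
(`exists_radius_norm_le`), hence nearby Jacobians also have rank exactly `r`. They are their own
rank-`r` projections, and the iteration is Gauss–Newton with the ordinary pseudoinverse.

A Gauss–Newton step leaves a residual orthogonal to the old range, up to a quadratic term, and the
new pseudoinverse almost annihilates it. So steps halve near `a` and the iterates converge to a
point `x̃` whose residual is orthogonal to the range of `J x̃`. Let `c` be the exact zero nearest to
`x̃`. Since the orbit of `c` consists of zeros, `x̃ - c` is orthogonal to `E c`, so the lower bound
applies to it; with stationarity this gives `‖x̃ - c‖ ≤ 4 ‖(J a)†‖ ‖y - b‖`, without a second-order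
term. By degrees, every exact zero is a GCD triple. At exact data `x̃` is itself a zero, and the
step estimate becomes quadratic. `newtonIter_quadMap_converges` assembles this. -/

theorem eq_zero_of_frobNorm_le_zero {A : V →L[ℂ] W} (h : frobNorm A ≤ 0) : A = 0 := by
  have h1 : ∑ i, ‖A (stdOrthonormalBasis ℂ V i)‖ ^ 2 = 0 := by
    have h2 : frobNorm A = 0 := le_antisymm h (Real.sqrt_nonneg _)
    exact (Real.sqrt_eq_zero (Finset.sum_nonneg fun i _ => sq_nonneg _)).1 h2
  have h3 := (Finset.sum_eq_zero_iff_of_nonneg fun i _ => sq_nonneg _).1 h1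
  have h4 : (A : V →ₗ[ℂ] W) = 0 := by
    refine (stdOrthonormalBasis ℂ V).toBasis.ext fun i => ?_
    simpa using h3 i (Finset.mem_univ i)
  exact ContinuousLinearMap.coe_injective h4

theorem frobNorm_nonneg (A : V →L[ℂ] W) : 0 ≤ frobNorm A := Real.sqrt_nonneg _

theorem frobNorm_zero : frobNorm (0 : V →L[ℂ] W) = 0 := by simp [frobNorm]

theorem isRankProj_iff_eq {r : ℕ} {A : V →L[ℂ] W} (h : rk A = r) (B : V →L[ℂ] W) :
    IsRankProj r A B ↔ B = A := by
  constructor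
  · intro hB
    have := hB.2 A h
    rw [sub_self, frobNorm_zero] at this
    exact sub_eq_zero.1 (eq_zero_of_frobNorm_le_zero this)
  · rintro rfl
    refine ⟨h, fun C _ => ?_⟩
    rw [sub_self, frobNorm_zero]
    exact frobNorm_nonneg _

theorem existsUnique_isRankProj {r : ℕ} {A : V →L[ℂ] W} (h : rk A = r) :
    ∃! B, IsRankProj r A B :=
  ⟨A, (isRankProj_iff_eq h A).2 rfl, fun B hB => (isRankProj_iff_eq h B).1 hB⟩

theorem rankProj_eq_self {r : ℕ} {A : V →L[ℂ] W} (h : rk A = r) : rankProj r A = A := by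
  have hex : ∃ B, IsRankProj r A B := (existsUnique_isRankProj h).exists
  rw [rankProj, dif_pos hex]
  exact (isRankProj_iff_eq h _).1 hex.choose_spec

variable [FiniteDimensional ℂ W]

theorem inner_pinv_of_apply_eq_zero (A : V →L[ℂ] W) (w : W) {z : V} (hz : A z = 0) :
    inner ℂ z (pinv A w) = 0 := by
  have : pinv A w ∈ (LinearMap.ker (A : V →ₗ[ℂ] W))ᗮ := by
    simp only [pinv, LinearMap.coe_toContinuousLinearMap', LinearMap.comp_apply]
    exact Submodule.coe_mem _
  exact (Submodule.mem_orthogonal _ _).1 this z hz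

theorem apply_pinv (A : V →L[ℂ] W) (w : W) :
    A (pinv A w) = (LinearMap.range (A : V →ₗ[ℂ] W)).orthogonalProjectionOnto w := by
  have h := LinearEquiv.apply_symm_apply ((A : V →ₗ[ℂ] W).kerComplementEquivRange
        (Submodule.isCompl_orthogonal (LinearMap.ker (A : V →ₗ[ℂ] W))).symm)
        ((LinearMap.range (A : V →ₗ[ℂ] W)).orthogonalProjectionOnto w)
  have h' := congrArg Subtype.val h
  exact h'

theorem inner_apply_sub_apply_pinv (A : V →L[ℂ] W) (w : W) (z : V) :
    inner ℂ (A z) (w - A (pinv A w)) = 0 := by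
  rw [apply_pinv]
  have h := Submodule.sub_starProjection_mem_orthogonal
    (K := LinearMap.range (A : V →ₗ[ℂ] W)) w
  exact (Submodule.mem_orthogonal _ _).1 h (A z) ⟨z, rfl⟩

/-- On the orthogonal complement of the kernel the pseudoinverse is a left inverse. This is how the
condition number enters as a lower bound for the Jacobian. -/
theorem norm_le_norm_pinv_mul (A : V →L[ℂ] W) {z : V}
    (hz : ∀ a, A a = 0 → inner ℂ a z = 0) : ‖z‖ ≤ ‖pinv A‖ * ‖A z‖ := by
  have h1 : A (z - pinv A (A z)) = 0 := by
    have := inner_apply_sub_apply_pinv A (A z) (z - pinv A (A z))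
    rw [← map_sub] at this
    exact inner_self_eq_zero.1 this
  have h2 : z - pinv A (A z) = 0 := by
    have h3 : inner ℂ (z - pinv A (A z)) (z - pinv A (A z)) = 0 := by
      rw [inner_sub_right, hz _ h1, inner_pinv_of_apply_eq_zero A _ h1, sub_zero]
    exact inner_self_eq_zero.1 h3
  calc ‖z‖ = ‖pinv A (A z)‖ := by rw [← sub_eq_zero.1 h2]
    _ ≤ _ := (pinv A).le_opNorm _

theorem norm_apply_pinv_le (A : V →L[ℂ] W) (w : W) : ‖A (pinv A w)‖ ≤ ‖w‖ := by
  rw [apply_pinv]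
  exact Submodule.norm_orthogonalProjectionOnto_apply_le _ w

theorem norm_sub_apply_pinv_le (A : V →L[ℂ] W) (w : W) (z : V) :
    ‖w - A (pinv A w)‖ ≤ ‖w - A z‖ := by
  have h := inner_apply_sub_apply_pinv A w (z - pinv A w)
  rw [← inner_conj_symm, map_eq_zero] at h
  have h2 : w - A z = (w - A (pinv A w)) - A (z - pinv A w) := by
    rw [map_sub]; abel
  have h3 := norm_sub_sq (𝕜 := ℂ) (w - A (pinv A w)) (A (z - pinv A w))
  rw [← h2, h] at h3
  simp only [map_zero, mul_zero, sub_zero] at h3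
  exact (sq_le_sq₀ (norm_nonneg _) (norm_nonneg _)).1 (by nlinarith [sq_nonneg ‖A (z - pinv A w)‖])

theorem norm_pinv_apply_le {A : V →L[ℂ] W} {β : ℝ} (hβ : 0 ≤ β)
    (hA : ∀ z, (∀ a, A a = 0 → inner ℂ a z = 0) → ‖z‖ ≤ β * ‖A z‖) (w : W) :
    ‖pinv A w‖ ≤ β * ‖w‖ :=
  (hA _ fun _ ha => inner_pinv_of_apply_eq_zero A w ha).trans
    (mul_le_mul_of_nonneg_left (norm_apply_pinv_le A w) hβ)

/-- The pseudoinverse of `A` kills `w`, so that of a nearby `B` nearly does: with `s = B† w`, `‖B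
s‖² = ⟪B s, w⟫ = ⟪(B - A) s, w⟫`, and one factor `‖s‖` cancels against the lower bound for `B`. -/
theorem norm_pinv_apply_le_of_orthogonal {A B : V →L[ℂ] W} {β : ℝ}
    (hB : ∀ z, (∀ a, B a = 0 → inner ℂ a z = 0) → ‖z‖ ≤ β * ‖B z‖) {w : W}
    (hw : ∀ z, inner ℂ (A z) w = 0) : ‖pinv B w‖ ≤ β ^ 2 * ‖B - A‖ * ‖w‖ := by
  set s := pinv B w with hs
  have h1 : ‖s‖ ≤ β * ‖B s‖ := hB _ fun _ ha => inner_pinv_of_apply_eq_zero B w ha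
  have h2 : inner ℂ (B s) (B s) = inner ℂ ((B - A) s) w := by
    have := inner_apply_sub_apply_pinv B w s
    rw [inner_sub_right, sub_eq_zero] at this
    rw [← this, sub_apply, inner_sub_left, hw, sub_zero]
  have h3 : ‖B s‖ ^ 2 ≤ ‖B - A‖ * ‖s‖ * ‖w‖ := by
    have h4 : ‖inner ℂ (B s) (B s)‖ = ‖B s‖ ^ 2 := by
      rw [inner_self_eq_norm_sq_to_K]; simp
    rw [← h4, h2]
    exact (norm_inner_le_norm _ _).trans
      (mul_le_mul_of_nonneg_right ((B - A).le_opNorm s) (norm_nonneg _))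
  rcases (norm_nonneg s).eq_or_lt with h0 | h0
  · rw [← h0]; positivity
  · have h5 : ‖s‖ ^ 2 ≤ β ^ 2 * ‖B s‖ ^ 2 := by
      rw [← mul_pow]; exact pow_le_pow_left₀ (norm_nonneg _) h1 2
    have h6 : ‖s‖ * ‖s‖ ≤ (β ^ 2 * ‖B - A‖ * ‖w‖) * ‖s‖ := by
      nlinarith [mul_le_mul_of_nonneg_left h3 (sq_nonneg β)]
    exact le_of_mul_le_mul_right h6 h0

end PseudoInverse

/-! ### Iterations with halving steps. -/

section Sequences

variable {V : Type*} [NormedAddCommGroup V]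

/-- If a step map halves the length of its steps on a ball, its iterates stay in the ball and
converge, with an error of at most twice the length of the current step. -/
theorem exists_tendsto_iterate_of_step_halving [CompleteSpace V] {g : V → V} {a x₀ : V} {R : ℝ}
    (hg : ∀ x, ‖x - a‖ ≤ R → ‖g x - a‖ ≤ R → ‖g (g x) - g x‖ ≤ ‖g x - x‖ / 2)
    (h0 : ‖x₀ - a‖ + 2 * ‖g x₀ - x₀‖ ≤ R) :
    (∀ j, ‖g^[j] x₀ - a‖ ≤ R) ∧ ∃ xt, Tendsto (fun j => g^[j] x₀) atTop (𝓝 xt) ∧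
      ‖xt - a‖ ≤ R ∧ ∀ j, ‖g^[j] x₀ - xt‖ ≤ 2 * ‖g^[j + 1] x₀ - g^[j] x₀‖ := by
  -- This sum does not grow: a step of length `d` moves away from `a` by at most `d`, while halving
  -- lowers the second term from `2 d` to at most `d`.
  have hinv : ∀ j, ‖g^[j] x₀ - a‖ + 2 * ‖g^[j + 1] x₀ - g^[j] x₀‖ ≤ R := by
    intro j
    induction j with
    | zero => simpa using h0
    | succ j ih =>
      have e1 : ∀ i, g^[i + 1] x₀ = g (g^[i] x₀) := fun i => Function.iterate_succ_apply' g i x₀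
      rw [e1 (j + 1), e1 j]
      rw [e1 j] at ih
      have t : ‖g (g^[j] x₀) - a‖ ≤ ‖g (g^[j] x₀) - g^[j] x₀‖ + ‖g^[j] x₀ - a‖ :=
        norm_sub_le_norm_sub_add_norm_sub _ _ _
      have n1 := norm_nonneg (g (g^[j] x₀) - g^[j] x₀)
      have := hg (g^[j] x₀) (by linarith) (by linarith)
      linarith
  have hball : ∀ j, ‖g^[j] x₀ - a‖ ≤ R := fun j => by
    linarith [hinv j, norm_nonneg (g^[j + 1] x₀ - g^[j] x₀)]
  have hhalf : ∀ j, ‖g^[j + 2] x₀ - g^[j + 1] x₀‖ ≤ ‖g^[j + 1] x₀ - g^[j] x₀‖ / 2 := by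
    intro j
    have h1 := hball j
    have h2 := hball (j + 1)
    rw [Function.iterate_succ_apply' g (j + 1), Function.iterate_succ_apply' g j] at *
    exact hg _ h1 h2
  have hgeo : ∀ j i, dist (g^[j + i] x₀) (g^[j + (i + 1)] x₀)
      ≤ 2 * ‖g^[j + 1] x₀ - g^[j] x₀‖ / 2 / 2 ^ i := by
    intro j i
    induction i with
    | zero => rw [dist_comm, dist_eq_norm]; simp
    | succ i ih =>
      rw [dist_comm, dist_eq_norm] at ih ⊢
      have := hhalf (j + i)
      calc _ ≤ ‖g^[j + (i + 1)] x₀ - g^[j + i] x₀‖ / 2 := this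
        _ ≤ _ := by
          rw [pow_succ, ← div_div]
          exact div_le_div_of_nonneg_right ih (by norm_num)
  have hcau : CauchySeq fun i => g^[0 + i] x₀ := cauchySeq_of_le_geometric_two (hgeo 0)
  obtain ⟨xt, hxt⟩ := cauchySeq_tendsto_of_complete hcau
  have hxt' : Tendsto (fun j => g^[j] x₀) atTop (𝓝 xt) := by simpa using hxt
  refine ⟨hball, xt, hxt', ?_, fun j => ?_⟩
  · exact le_of_tendsto (hxt'.sub_const a).norm (Eventually.of_forall hball)
  · have hj : Tendsto (fun i => g^[j + i] x₀) atTop (𝓝 xt) := by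
      simpa [add_comm] using (tendsto_add_atTop_iff_nat j).2 hxt'
    have := dist_le_of_le_geometric_two_of_tendsto₀ (hgeo j) hj
    simpa [dist_eq_norm] using this

end Sequences

/-! ### Quadratic maps with a hyperbolic symmetry. -/

section Quadratic

variable {V W : Type*}
  [NormedAddCommGroup V] [InnerProductSpace ℂ V]
  [NormedAddCommGroup W] [InnerProductSpace ℂ W]

/-- The inhomogeneous quadratic map `x ↦ J x x / 2 - y`, whose derivative at `x` is `J x` if the
bilinear map `J` is symmetric. -/
def quadMap (J : V →L[ℂ] V →L[ℂ] W) (y : W) (x : V) : W := (1 / 2 : ℂ) • J x x - y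

variable {J : V →L[ℂ] V →L[ℂ] W} {E : V →ₗᵢ[ℂ] V}

theorem quadMap_add (hJ : ∀ x z, J x z = J z x) (y : W) (x s : V) :
    quadMap J y (x + s) = quadMap J y x + J x s + (1 / 2 : ℂ) • J s s := by
  simp only [quadMap, map_add, add_apply, hJ s x]
  module

theorem fderiv_quadMap (hJ : ∀ x z, J x z = J z x) (y : W) (x : V) :
    fderiv ℂ (quadMap J y) x = J x := by
  have h := (((J.hasFDerivAt (x := x)).clm_apply (hasFDerivAt_id x)).const_smul
    (1 / 2 : ℂ)).sub_const y
  refine HasFDerivAt.fderiv (h.congr_fderiv ?_)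
  ext z
  simp only [smul_apply, add_apply, ContinuousLinearMap.comp_apply, ContinuousLinearMap.id_apply,
    ContinuousLinearMap.flip_apply, id, hJ z x]
  module

theorem continuous_quadMap (y : W) : Continuous (quadMap J y) := by
  unfold quadMap
  fun_prop

theorem norm_half_smul_le (s : V) : ‖(1 / 2 : ℂ) • J s s‖ ≤ ‖J‖ / 2 * ‖s‖ ^ 2 := by
  rw [norm_smul]
  have := J.le_opNorm₂ s s
  norm_num
  nlinarith

theorem norm_quadMap_le (hJ : ∀ x z, J x z = J z x) {y b : W} {a x : V} (ha : quadMap J b a = 0)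
    {ρ : ℝ} (hx : ‖x - a‖ ≤ ρ) :
    ‖quadMap J y x‖ ≤ ‖J‖ * (‖a‖ + ρ) * ‖x - a‖ + ‖y - b‖ := by
  have h1 : quadMap J y x = J a (x - a) + (1 / 2 : ℂ) • J (x - a) (x - a) + (b - y) := by
    have h := quadMap_add hJ b a (x - a)
    rw [ha, add_sub_cancel, zero_add] at h
    rw [← h]
    simp [quadMap]
  have h2 := J.le_opNorm₂ a (x - a)
  have h3 := norm_half_smul_le (J := J) (x - a)
  have h4 := norm_add₃_le (a := J a (x - a)) (b := (1 / 2 : ℂ) • J (x - a) (x - a)) (c := b - y)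
  rw [h1, norm_sub_rev y b]
  have h5 : ‖J‖ * ‖x - a‖ ^ 2 ≤ ‖J‖ * ρ * ‖x - a‖ := by
    rw [pow_two, ← mul_assoc]
    gcongr
  have h6 : 0 ≤ ‖J‖ * ‖x - a‖ ^ 2 := by positivity
  nlinarith

/-- Along the hyperbolic orbits of a linear involution `E` with `J x (E x) = 0` the quadratic map
is constant. -/
theorem quadMap_orbit (hJ : ∀ x z, J x z = J z x) (hE : ∀ x, E (E x) = x)
    (hJE : ∀ x, J x (E x) = 0) (y : W) (x : V) (t : ℂ) :
    quadMap J y (Complex.cosh t • x + Complex.sinh t • E x) = quadMap J y x := by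
  -- Polarization: apply `J x (E x) = 0` at `x + E x`.
  have h1 : J (E x) (E x) = - J x x := by
    have h := hJE (x + E x)
    simp only [map_add, hE, add_apply, hJE x, zero_add, hJ (E x) x, add_zero] at h
    exact eq_neg_of_add_eq_zero_left h
  have h2 := Complex.cosh_sq_sub_sinh_sq t
  simp only [quadMap, map_add, map_smul, add_apply, smul_apply, hJ (E x) x, hJE x, h1]
  congr 2
  trans (Complex.cosh t ^ 2 - Complex.sinh t ^ 2) • J x x
  · module
  · rw [h2, one_smul]

/-- The orbit of `c` consists of zeros, so the squared distance from `x` along it is minimal at `c`,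
where the orbit has tangent `E c`. -/
theorem inner_eq_zero_of_nearest_zero (hJ : ∀ x z, J x z = J z x) (hE : ∀ x, E (E x) = x)
    (hJE : ∀ x, J x (E x) = 0) {b : W} {x c : V} (hc : quadMap J b c = 0)
    (hmin : ∀ c', quadMap J b c' = 0 → ‖x - c‖ ≤ ‖x - c'‖) : inner ℂ (E c) (x - c) = 0 := by
  -- The orbit parameter is complex; the real directions `ω = 1` and `ω = I` give the real and
  -- imaginary parts.
  have key : ∀ ω : ℂ, RCLike.re (inner ℂ (x - c) (ω • E c)) = 0 := by
    intro ω
    let _ : InnerProductSpace ℝ V := InnerProductSpace.rclikeToReal ℂ V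
    let γ : ℝ → V := fun s => x - (Complex.cosh (s * ω) • c + Complex.sinh (s * ω) • E c)
    have hγ0 : γ 0 = x - c := by simp [γ]
    have hlin : HasDerivAt (fun s : ℂ => s * ω) ω ((0 : ℝ) : ℂ) := by
      simpa using (hasDerivAt_id ((0 : ℝ) : ℂ)).mul_const ω
    have hd : HasDerivAt γ (-(ω • E c)) 0 := by
      have h1 : HasDerivAt (fun s : ℝ => Complex.cosh (s * ω)) 0 0 := by
        simpa using hlin.ccosh.comp_ofReal
      have h2 : HasDerivAt (fun s : ℝ => Complex.sinh (s * ω)) ω 0 := by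
        simpa using hlin.csinh.comp_ofReal
      have h3 := ((h1.smul_const c).add (h2.smul_const (E c))).const_sub x
      simpa using h3
    have hmin' : IsLocalMin (fun s => ‖γ s‖ ^ 2) 0 := by
      refine Eventually.of_forall fun s => ?_
      change ‖γ 0‖ ^ 2 ≤ ‖γ s‖ ^ 2
      rw [hγ0]
      exact pow_le_pow_left₀ (norm_nonneg _)
        (hmin _ ((quadMap_orbit hJ hE hJE b c _).trans hc)) 2
    have h4 := hmin'.hasDerivAt_eq_zero hd.norm_sq
    rw [hγ0, inner_neg_right] at h4
    have h5 : inner ℝ (x - c) (ω • E c) = 0 := by linarith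
    exact h5
  have h1 := key 1
  have h2 := key Complex.I
  rw [one_smul] at h1
  rw [inner_smul_right] at h2
  simp only [RCLike.re_to_complex, Complex.mul_re, Complex.I_re, zero_mul, Complex.I_im, one_mul,
    zero_sub, neg_eq_zero] at h1 h2
  rw [← inner_conj_symm, map_eq_zero]
  exact Complex.ext h1 h2

theorem exists_nearest_zero [FiniteDimensional ℂ V] (hJ : ∀ x z, J x z = J z x)
    (hE : ∀ x, E (E x) = x) (hJE : ∀ x, J x (E x) = 0) {b : W} {a : V} (ha : quadMap J b a = 0)
    (x : V) :
    ∃ c, quadMap J b c = 0 ∧ ‖x - c‖ ≤ ‖x - a‖ ∧ inner ℂ (E c) (x - c) = 0 := by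
  have : ProperSpace V := FiniteDimensional.proper ℂ V
  have hcl : IsClosed {c : V | quadMap J b c = 0} :=
    isClosed_singleton.preimage (continuous_quadMap b)
  obtain ⟨c, hc, hd⟩ := hcl.exists_infDist_eq_dist ⟨a, ha⟩ x
  have hmin : ∀ c', quadMap J b c' = 0 → ‖x - c‖ ≤ ‖x - c'‖ := by
    intro c' hc'
    rw [← dist_eq_norm, ← dist_eq_norm, ← hd]
    exact Metric.infDist_le_dist_of_mem hc'
  exact ⟨c, hc, hmin a ha, inner_eq_zero_of_nearest_zero hJ hE hJE hc hmin⟩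

theorem inner_sub_smul_eq_zero {e : V} (he : e ≠ 0) (z : V) :
    inner ℂ e (z - (inner ℂ e z / inner ℂ e e) • e) = 0 := by
  rw [inner_sub_right, inner_smul_right, div_mul_cancel₀ _ (inner_self_ne_zero.2 he), sub_self]

/-- The lower bound for the Jacobian on the orthogonal complement of its kernel is stable. -/
theorem exists_radius_norm_le (hJE : ∀ x, J x (E x) = 0) {a : V} (ha : a ≠ 0) {κ : ℝ}
    (hκ0 : 0 ≤ κ) (hκ : ∀ z, inner ℂ (E a) z = 0 → ‖z‖ ≤ κ * ‖J a z‖) :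
    ∃ ρ, 0 < ρ ∧ ρ < ‖a‖ ∧ ∀ x x' z, ‖x - a‖ ≤ ρ → ‖x' - a‖ ≤ ρ → inner ℂ (E x') z = 0 →
      ‖z‖ ≤ 2 * κ * ‖J x z‖ := by
  have ha' : 0 < ‖a‖ := norm_pos_iff.2 ha
  -- The two terms weigh the change of the Jacobian and the tilt of `E x'` against `E a`; at radius
  -- `1 / (2 D)` their total effect is `‖z‖ / 2`, which is absorbed.
  set D := κ * ‖J‖ + 1 / ‖a‖ with hD
  have hD0 : 0 < D := by positivity
  refine ⟨min (1 / (2 * D)) (‖a‖ / 2), by positivity, by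
    have := min_le_right (1 / (2 * D)) (‖a‖ / 2); linarith, fun x x' z hx hx' hz => ?_⟩
  replace hx := hx.trans (min_le_left _ _)
  replace hx' := hx'.trans (min_le_left _ _)
  have hEa : E a ≠ 0 := by rwa [← norm_ne_zero_iff, E.norm_map, norm_ne_zero_iff]
  set t := inner ℂ (E a) z / inner ℂ (E a) (E a) with ht
  have h1 := hκ _ (inner_sub_smul_eq_zero hEa z)
  rw [← ht, map_sub, map_smul, hJE a, smul_zero, sub_zero] at h1
  have h2 : ‖t • E a‖ ≤ 1 / (2 * D) * (1 / ‖a‖) * ‖z‖ := by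
    have h3 : inner ℂ (E a) z = inner ℂ (E (a - x')) z := by
      rw [map_sub, inner_sub_left, hz, sub_zero]
    have h4 : ‖inner ℂ (E a) z‖ ≤ 1 / (2 * D) * ‖z‖ := by
      rw [h3]
      refine (norm_inner_le_norm _ _).trans ?_
      rw [E.norm_map, norm_sub_rev]
      exact mul_le_mul_of_nonneg_right hx' (norm_nonneg _)
    have h5 : ‖inner ℂ (E a) (E a)‖ = ‖a‖ * ‖a‖ := by
      rw [inner_self_eq_norm_sq_to_K, E.norm_map]; simp [pow_two]
    rw [norm_smul, ht, norm_div, h5, E.norm_map]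
    calc _ = ‖inner ℂ (E a) z‖ * (1 / ‖a‖) := by field_simp
      _ ≤ 1 / (2 * D) * ‖z‖ * (1 / ‖a‖) := mul_le_mul_of_nonneg_right h4 (by positivity)
      _ = _ := by ring
  have h6 : ‖J a z‖ ≤ ‖J x z‖ + ‖J‖ * (1 / (2 * D)) * ‖z‖ := by
    have h7 : J a z = J x z - J (x - a) z := by
      rw [map_sub, sub_apply]; abel
    rw [h7]
    refine (norm_sub_le _ _).trans (add_le_add_right ((J.le_opNorm₂ _ _).trans ?_) _)
    gcongr
  have h8 : ‖z‖ ≤ ‖z - t • E a‖ + ‖t • E a‖ := by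
    simpa using norm_add_le (z - t • E a) (t • E a)
  have h9 : κ * (‖J‖ * (1 / (2 * D)) * ‖z‖) + 1 / (2 * D) * (1 / ‖a‖) * ‖z‖ = ‖z‖ / 2 := by
    have : κ * (‖J‖ * (1 / (2 * D)) * ‖z‖) + 1 / (2 * D) * (1 / ‖a‖) * ‖z‖
      = D * (1 / (2 * D)) * ‖z‖ := by rw [hD]; ring
    rw [this]; field_simp
  nlinarith [mul_le_mul_of_nonneg_left h6 hκ0]

/-- The symmetry puts `E x` into the kernel and the lower bound excludes anything more, so the rank
is constant near a zero. -/
theorem rk_eq_of_norm_le [FiniteDimensional ℂ V] (hJE : ∀ x, J x (E x) = 0) {x : V} (hx : x ≠ 0)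
    {β : ℝ} (hβ : ∀ z, inner ℂ (E x) z = 0 → ‖z‖ ≤ β * ‖J x z‖) {r : ℕ}
    (hr : Module.finrank ℂ V = r + 1) : rk (J x) = r := by
  have hEx : E x ≠ 0 := by rwa [← norm_ne_zero_iff, E.norm_map, norm_ne_zero_iff]
  have hker : LinearMap.ker (J x : V →ₗ[ℂ] W) = ℂ ∙ E x := by
    ext z
    rw [LinearMap.mem_ker, Submodule.mem_span_singleton]
    constructor
    · intro hz
      replace hz : J x z = 0 := hz
      have h := hβ _ (inner_sub_smul_eq_zero hEx z)
      rw [map_sub, map_smul, hJE, hz, smul_zero, sub_zero, norm_zero, mul_zero] at h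
      exact ⟨_, (sub_eq_zero.1 (norm_le_zero_iff.1 h)).symm⟩
    · rintro ⟨t, rfl⟩
      simp [hJE]
  have h := LinearMap.finrank_range_add_finrank_ker (J x : V →ₗ[ℂ] W)
  rw [hker, finrank_span_singleton hEx, hr] at h
  exact Nat.succ.inj h

/-- The distance of a stationary point for perturbed data to the zeros for the exact data. -/
theorem norm_sub_le_of_stationary (hJ : ∀ x z, J x z = J z x) {y b : W} {x c : V}
    (hc : quadMap J b c = 0) (hx : ∀ z, inner ℂ (J x z) (quadMap J y x) = 0) {κ : ℝ}
    (hκ0 : 0 ≤ κ) (hκ : ‖x - c‖ ≤ 2 * κ * ‖J x (x - c)‖)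
    (hsmall : 2 * κ * ‖J‖ * ‖x - c‖ ≤ 1) : ‖x - c‖ ≤ 4 * κ * ‖y - b‖ := by
  have h1 : J x (x - c) = quadMap J y x + ((1 / 2 : ℂ) • J (x - c) (x - c) + (y - b)) := by
    have h := quadMap_add hJ b x (c - x)
    rw [add_sub_cancel, hc, ← neg_sub x c] at h
    simp only [map_neg, neg_apply, neg_neg] at h
    have h' : quadMap J y x = quadMap J b x + (b - y) := by simp [quadMap]
    have h'' : J x (x - c) = quadMap J b x + (1 / 2 : ℂ) • J (x - c) (x - c) -
        (quadMap J b x + -J x (x - c) + (1 / 2 : ℂ) • J (x - c) (x - c)) := by abel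
    rw [← h, sub_zero] at h''
    rw [h', h'']
    abel
  have h2 : ‖J x (x - c)‖ ≤ ‖J‖ / 2 * ‖x - c‖ ^ 2 + ‖y - b‖ := by
    set e := (1 / 2 : ℂ) • J (x - c) (x - c) + (y - b) with he
    -- Stationarity removes the residual, which need not be small compared with `‖y - b‖ ^ 2`; only
    -- `e` remains.
    have h3 : inner ℂ (J x (x - c)) (J x (x - c)) = inner ℂ (J x (x - c)) e := by
      rw [← sub_eq_zero, ← inner_sub_right, h1, add_sub_cancel_right, ← h1, hx]
    have h4 : ‖J x (x - c)‖ * ‖J x (x - c)‖ ≤ ‖J x (x - c)‖ * ‖e‖ := by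
      have h5 : ‖inner ℂ (J x (x - c)) (J x (x - c))‖ = ‖J x (x - c)‖ * ‖J x (x - c)‖ := by
        rw [inner_self_eq_norm_sq_to_K]; simp [pow_two]
      rw [← h5, h3]
      exact norm_inner_le_norm _ _
    have h6 : ‖e‖ ≤ ‖J‖ / 2 * ‖x - c‖ ^ 2 + ‖y - b‖ :=
      (norm_add_le _ _).trans (add_le_add_left (norm_half_smul_le _) _)
    rcases (norm_nonneg (J x (x - c))).eq_or_lt with h0 | h0
    · rw [← h0]; positivity
    · exact (le_of_mul_le_mul_left h4 h0).trans h6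
  have h7 := mul_le_mul_of_nonneg_left h2 (show 0 ≤ 2 * κ by positivity)
  have h8 := mul_le_mul_of_nonneg_right hsmall (norm_nonneg (x - c))
  nlinarith

end Quadratic

/-! ### Local convergence of the Gauss–Newton iteration. -/

section GaussNewton

variable {V W : Type*}
  [NormedAddCommGroup V] [InnerProductSpace ℂ V] [FiniteDimensional ℂ V]
  [NormedAddCommGroup W] [InnerProductSpace ℂ W] [FiniteDimensional ℂ W]
  {J : V →L[ℂ] V →L[ℂ] W}

/-- The residual after a Gauss–Newton step is the part of the residual that is orthogonal to the
range of the Jacobian, up to a quadratic term; so the next step is small. -/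
theorem norm_pinv_quadMap_step_le (hJ : ∀ x z, J x z = J z x) (y : W) {x x' : V} {β : ℝ}
    (hβ0 : 0 ≤ β) (hx' : x' = x - pinv (J x) (quadMap J y x))
    (hβ : ∀ z, (∀ a, J x' a = 0 → inner ℂ a z = 0) → ‖z‖ ≤ β * ‖J x' z‖) :
    ‖pinv (J x') (quadMap J y x')‖ ≤
      β ^ 2 * ‖J‖ * ‖x' - x‖ * ‖quadMap J y x - J x (pinv (J x) (quadMap J y x))‖ +
        β * (‖J‖ / 2) * ‖x' - x‖ ^ 2 := by
  set s := pinv (J x) (quadMap J y x) with hs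
  have hxs : x' - x = -s := by rw [hx']; abel
  have h1 : quadMap J y x' = (quadMap J y x - J x s) + (1 / 2 : ℂ) • J (x' - x) (x' - x) := by
    have h := quadMap_add hJ y x (x' - x)
    rw [add_sub_cancel] at h
    rw [h, hxs, map_neg (J x)]
    abel
  rw [h1, map_add]
  refine (norm_add_le _ _).trans (add_le_add ?_ ?_)
  · refine (norm_pinv_apply_le_of_orthogonal hβ
      (inner_apply_sub_apply_pinv (J x) (quadMap J y x))).trans ?_
    rw [← map_sub, mul_assoc (β ^ 2) ‖J‖]
    have h2 := J.le_opNorm (x' - x)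
    have h3 := norm_nonneg (quadMap J y x - J x s)
    exact mul_le_mul_of_nonneg_right (mul_le_mul_of_nonneg_left h2 (sq_nonneg β)) h3
  · refine (norm_pinv_apply_le hβ0 hβ _).trans ?_
    rw [mul_assoc]
    exact mul_le_mul_of_nonneg_left (norm_half_smul_le _) hβ0

/-- At a limit of the Gauss–Newton iteration the residual is orthogonal to the range of the
Jacobian. -/
theorem inner_apply_quadMap_eq_zero_of_tendsto {y : W} {u : ℕ → V} {xt : V}
    (hu : ∀ j, u (j + 1) = u j - pinv (J (u j)) (quadMap J y (u j)))
    (hlim : Tendsto u atTop (𝓝 xt)) (z : V) : inner ℂ (J xt z) (quadMap J y xt) = 0 := by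
  have h1 : ∀ j, inner ℂ (J (u j) z) (quadMap J y (u j) - J (u j) (u j - u (j + 1))) = 0 := by
    intro j
    rw [hu j, sub_sub_cancel]
    exact inner_apply_sub_apply_pinv _ _ z
  have hlim' : Tendsto (fun j => u (j + 1)) atTop (𝓝 xt) := (tendsto_add_atTop_iff_nat 1).2 hlim
  have hcont : Continuous fun a : V × V =>
      inner ℂ (J a.1 z) (quadMap J y a.1 - J a.1 (a.1 - a.2)) := by
    have := continuous_quadMap (J := J) y
    fun_prop
  have h2 := (hcont.tendsto (xt, xt)).comp (hlim.prodMk_nhds hlim')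
  simp only [sub_self, map_zero, sub_zero] at h2
  refine tendsto_nhds_unique h2 ?_
  simpa only [Function.comp_def, h1] using tendsto_const_nhds

/-- The rank-`r` Newton iteration near a zero `a` at which the kernel of the Jacobian is spanned
by the generator `E a` of the hyperbolic orbit of zeros through `a`. -/
theorem newtonIter_quadMap_converges {E : V →ₗᵢ[ℂ] V} (hJ : ∀ x z, J x z = J z x)
    (hE : ∀ x, E (E x) = x) (hJE : ∀ x, J x (E x) = 0) {r : ℕ}
    (hr : Module.finrank ℂ V = r + 1) {a : V} {b : W} (ha0 : a ≠ 0) (ha : quadMap J b a = 0)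
    (hker : ∀ z, J a z = 0 → ∃ t : ℂ, z = t • E a) :
    ∃ ε : ℝ, 0 < ε ∧ ∃ K : ℝ, ∀ y, ‖y - b‖ < ε → ∀ x₀, ‖x₀ - a‖ < ε →
      (∀ j, rk (J (newtonIter r (quadMap J y) x₀ j)) = r) ∧
      ∃ xt, Tendsto (newtonIter r (quadMap J y) x₀) atTop (𝓝 xt) ∧
        (∃ c, quadMap J b c = 0 ∧ ‖xt - c‖ ≤ 4 * ‖pinv (J a)‖ * ‖y - b‖) ∧
        (y = b → ∀ j, ‖newtonIter r (quadMap J y) x₀ (j + 1) - xt‖ ≤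
          K * ‖newtonIter r (quadMap J y) x₀ j - xt‖ ^ 2) := by
  set κ := ‖pinv (J a)‖ with hκ
  have hκ0 : 0 ≤ κ := norm_nonneg _
  have hκa : ∀ z, inner ℂ (E a) z = 0 → ‖z‖ ≤ κ * ‖J a z‖ := fun z hz => by
    refine norm_le_norm_pinv_mul (J a) fun d hd => ?_
    obtain ⟨t, rfl⟩ := hker d hd
    rw [inner_smul_left, hz, mul_zero]
  obtain ⟨ρ, hρ0, hρa, hρ⟩ := exists_radius_norm_le hJE ha0 hκ0 hκa
  set L := ‖J‖ with hL
  have hL0 : 0 ≤ L := norm_nonneg J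
  set β := 2 * κ with hβ
  have hβ0 : 0 ≤ β := by positivity
  set M := L * (‖a‖ + ρ) with hM
  have hM0 : 0 ≤ M := by positivity
  have hbound : ∀ x, ‖x - a‖ ≤ ρ →
      ∀ z, (∀ d, J x d = 0 → inner ℂ d z = 0) → ‖z‖ ≤ β * ‖J x z‖ := fun x hx z hz =>
    hρ x x z hx hx (hz _ (hJE x))
  have hrk : ∀ x, ‖x - a‖ ≤ ρ → rk (J x) = r := fun x hx => by
    refine rk_eq_of_norm_le hJE ?_ (fun z hz => hρ x x z hx hx hz) hr
    rintro rfl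
    rw [zero_sub, norm_neg] at hx
    linarith
  -- the radius of the ball in which the steps are halved
  obtain ⟨R, hR0, hRρ, hR1, hR2⟩ : ∃ R, 0 < R ∧ 2 * R ≤ ρ ∧ 3 * β ^ 2 * L * ((M + 1) * R) ≤ 1 ∧
      β * L * R ≤ 1 := by
    set D := 3 * β ^ 2 * L * (M + 1) + β * L + 1 with hD
    have hD0 : 0 < D := by positivity
    have h1 : 0 ≤ 3 * β ^ 2 * L * (M + 1) := by positivity
    have h2 : 0 ≤ β * L := by positivity
    have h3 : 0 < min (ρ / 2) (1 / D) := by positivity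
    have h4 : D * min (ρ / 2) (1 / D) ≤ 1 := by
      have := mul_le_mul_of_nonneg_left (min_le_right (ρ / 2) (1 / D)) hD0.le
      rwa [mul_one_div_cancel hD0.ne'] at this
    refine ⟨_, h3, ?_, ?_, ?_⟩
    · linarith [min_le_left (ρ / 2) (1 / D)]
    · nlinarith [mul_nonneg h2 h3.le]
    · nlinarith [mul_nonneg h1 h3.le]
  -- The initial residual is at most `(M + 1) ε` and the first step at most `β` times that, so this
  -- is the starting condition of the halving lemma.
  obtain ⟨ε, hε0, hεR, hε⟩ : ∃ ε, 0 < ε ∧ ε ≤ R ∧ ε + 2 * (β * ((M + 1) * ε)) ≤ R := by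
    set D := 1 + 2 * (β * (M + 1)) with hD
    have h1 : 0 ≤ 2 * (β * (M + 1)) := by positivity
    have hD0 : 0 < D := by positivity
    have h2 : D * (R / D) = R := by field_simp
    have h3 : 0 < R / D := by positivity
    exact ⟨R / D, h3, by nlinarith, by nlinarith⟩
  refine ⟨ε, hε0, 2 * (β ^ 2 * L ^ 2 * R + β ^ 3 * L / 2 * (L * (‖a‖ + R + 2 * R)) ^ 2),
    fun y hy x₀ hx₀ => ?_⟩
  set F := quadMap J y with hF
  set g := newtonStep r F with hg
  have hstep : ∀ x, ‖x - a‖ ≤ ρ → g x = x - pinv (J x) (F x) := fun x hx => by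
    rw [hg, newtonStep, hF, fderiv_quadMap hJ, rankProj_eq_self (hrk x hx)]
  have hlen : ∀ x, ‖x - a‖ ≤ ρ → ‖g x - x‖ ≤ β * ‖F x‖ := fun x hx => by
    rw [hstep x hx, sub_sub_cancel_left, norm_neg]
    exact norm_pinv_apply_le hβ0 (hbound x hx) _
  have hnext : ∀ x, ‖x - a‖ ≤ R → ‖g x - a‖ ≤ R → ‖g (g x) - g x‖ ≤
      β ^ 2 * L * ‖g x - x‖ * ‖F x - J x (pinv (J x) (F x))‖ + β * (L / 2) * ‖g x - x‖ ^ 2 := by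
    intro x hx hgx
    have hgx' : ‖g x - a‖ ≤ ρ := by linarith
    rw [hstep (g x) hgx', sub_sub_cancel_left, norm_neg]
    exact norm_pinv_quadMap_step_le hJ y hβ0 (hstep x (by linarith)) (hbound _ hgx')
  have hhalf : ∀ x, ‖x - a‖ ≤ R → ‖g x - a‖ ≤ R → ‖g (g x) - g x‖ ≤ ‖g x - x‖ / 2 := by
    intro x hx hgx
    have hxρ : ‖x - a‖ ≤ ρ := by linarith
    have h1 := norm_quadMap_le hJ (y := y) ha hxρ
    rw [← hL, ← hM, ← hF] at h1
    have h2 : ‖F x‖ ≤ (M + 1) * R := by nlinarith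
    have h3 := hlen x hxρ
    have h4 : ‖F x - J x (pinv (J x) (F x))‖ ≤ ‖F x‖ := by
      simpa using norm_sub_apply_pinv_le (J x) (F x) 0
    have h5 : β ^ 2 * L * ‖F x‖ ≤ 1 / 3 := by
      have := mul_le_mul_of_nonneg_left h2 (show 0 ≤ β ^ 2 * L by positivity)
      linarith
    have h6 : β * (L / 2) * ‖g x - x‖ ≤ 1 / 6 := by
      have := mul_le_mul_of_nonneg_left h3 (show 0 ≤ β * (L / 2) by positivity)
      linarith
    -- The contraction factor is `1/3 + 1/6 = 1/2`, which explains the `3` in the choice of `R`.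
    have h7 : β ^ 2 * L * ‖F x - J x (pinv (J x) (F x))‖ ≤ 1 / 3 :=
      (mul_le_mul_of_nonneg_left h4 (by positivity)).trans h5
    have h8 := norm_nonneg (g x - x)
    have h9 := mul_le_mul_of_nonneg_right h6 h8
    have h10 := mul_le_mul_of_nonneg_right h7 h8
    have := hnext x hx hgx
    linarith
  have hstart : ‖x₀ - a‖ + 2 * ‖g x₀ - x₀‖ ≤ R := by
    have hxρ : ‖x₀ - a‖ ≤ ρ := by linarith
    have h1 := norm_quadMap_le hJ (y := y) ha hxρ
    rw [← hL, ← hM, ← hF] at h1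
    have h2 : ‖F x₀‖ ≤ (M + 1) * ε := by nlinarith
    have h3 := hlen x₀ hxρ
    have h4 := mul_le_mul_of_nonneg_left h2 hβ0
    linarith
  obtain ⟨hball, xt, hlim, hxt, herr⟩ := exists_tendsto_iterate_of_step_halving hhalf hstart
  have hsucc : ∀ j, g^[j + 1] x₀ = g (g^[j] x₀) := fun j => Function.iterate_succ_apply' g j x₀
  have hbig : ∀ {x : V}, ‖x - a‖ ≤ R → ‖x - a‖ ≤ ρ := fun hx => by linarith
  obtain ⟨c, hc, hxc, horth⟩ := exists_nearest_zero hJ hE hJE ha xt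
  -- Both `xt - c` and `xt - a` have length at most `R`; this needs `2 * R ≤ ρ`.
  have hca : ‖c - a‖ ≤ ρ := by
    have := norm_sub_le_norm_sub_add_norm_sub c xt a
    rw [norm_sub_rev c xt] at this
    linarith
  have hstat := inner_apply_quadMap_eq_zero_of_tendsto
    (fun j => (hsucc j).trans (hstep _ (hbig (hball j)))) hlim
  have hdist : ‖xt - c‖ ≤ 4 * κ * ‖y - b‖ := by
    refine norm_sub_le_of_stationary hJ hc hstat hκ0 (hρ xt c _ (hbig hxt) hca horth) ?_
    have := mul_le_mul_of_nonneg_left (hxc.trans hxt) (show 0 ≤ β * L by positivity)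
    linarith
  refine ⟨fun j => hrk _ (hbig (hball j)), xt, hlim, ⟨c, hc, hdist⟩, ?_⟩
  rintro rfl j
  have hzero : F xt = 0 := by
    rw [sub_self, norm_zero, mul_zero] at hdist
    rw [sub_eq_zero.1 (norm_le_zero_iff.1 hdist)]
    exact hc
  change ‖g^[j + 1] x₀ - xt‖ ≤ _ * ‖g^[j] x₀ - xt‖ ^ 2
  set x := g^[j] x₀ with hx
  have hxR : ‖x - a‖ ≤ R := hball j
  have hgxR : ‖g x - a‖ ≤ R := hsucc j ▸ hball (j + 1)
  have herr' := herr (j + 1)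
  rw [hsucc (j + 1), hsucc j] at herr'
  rw [hsucc j]
  have he2 : ‖x - xt‖ ≤ 2 * R := by
    have := norm_sub_le_norm_sub_add_norm_sub x a xt
    rw [norm_sub_rev a xt] at this
    linarith
  -- The least-squares residual is compared with that of the exact correction `x - xt`, which is the
  -- Taylor remainder at the zero `xt`.
  have hw : ‖F x - J x (pinv (J x) (F x))‖ ≤ L / 2 * ‖x - xt‖ ^ 2 := by
    refine (norm_sub_apply_pinv_le (J x) (F x) (x - xt)).trans ?_
    have h := quadMap_add hJ y x (xt - x)
    rw [add_sub_cancel, ← hF, hzero, ← neg_sub x xt] at h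
    simp only [map_neg, neg_apply, neg_neg] at h
    have h' : F x - J x (x - xt) = -((1 / 2 : ℂ) • J (x - xt) (x - xt)) := by
      rw [← sub_eq_zero, h]; abel
    rw [h', norm_neg]
    exact norm_half_smul_le _
  have hFx : ‖F x‖ ≤ L * (‖a‖ + R + 2 * R) * ‖x - xt‖ := by
    have h := norm_quadMap_le hJ (y := y) (b := y) hzero he2
    rw [sub_self, norm_zero, add_zero] at h
    refine h.trans ?_
    have : ‖xt‖ ≤ ‖a‖ + R := by
      have := norm_le_norm_add_norm_sub' xt a
      linarith
    gcongr
  have hd1 : ‖g x - x‖ ≤ 2 * R := by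
    have := norm_sub_le_norm_sub_add_norm_sub (g x) a x
    rw [norm_sub_rev a x] at this
    linarith
  have hd2 : ‖g x - x‖ ≤ β * (L * (‖a‖ + R + 2 * R) * ‖x - xt‖) :=
    (hlen x (hbig hxR)).trans (mul_le_mul_of_nonneg_left hFx hβ0)
  -- In the first term the residual is already quadratic and the crude bound `2 * R` for the step
  -- suffices; the second needs the linear bound `hd2`. The error is at most twice the next step,
  -- hence the factor `2` in `K`.
  have hfin : ‖g (g x) - g x‖ ≤ β ^ 2 * L * (2 * R) * (L / 2 * ‖x - xt‖ ^ 2) +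
      β * (L / 2) * (β * (L * (‖a‖ + R + 2 * R) * ‖x - xt‖)) ^ 2 := by
    refine (hnext x hxR hgxR).trans ?_
    gcongr
  linarith

end GaussNewton

/-! ### Polynomials and coefficient vectors. -/

section Coefficients

theorem coeff_toPoly {l : ℕ} (u : PolySpace l) (i : ℕ) :
    (toPoly u).coeff i = if h : i < l + 1 then u ⟨i, h⟩ else 0 := by
  simp only [toPoly, finsetSum_coeff, coeff_C_mul_X_pow]
  split_ifs with h
  · rw [Finset.sum_eq_single ⟨i, h⟩] <;> simp +contextual [Fin.ext_iff, eq_comm]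
  · refine Finset.sum_eq_zero fun j _ => if_neg ?_
    have := j.2
    omega

theorem natDegree_toPoly_le {l : ℕ} (u : PolySpace l) : (toPoly u).natDegree ≤ l := by
  rw [natDegree_le_iff_coeff_eq_zero]
  intro i hi
  rw [coeff_toPoly, dif_neg (by omega)]

theorem ofPoly_toPoly {l : ℕ} (u : PolySpace l) : ofPoly l (toPoly u) = u := by
  ext i
  change (toPoly u).coeff i = u i
  rw [coeff_toPoly, dif_pos i.2]

theorem toPoly_injective {l : ℕ} : Function.Injective (toPoly : PolySpace l → ℂ[X]) :=
  Function.LeftInverse.injective ofPoly_toPoly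

theorem toPoly_ofPoly {l : ℕ} {P : ℂ[X]} (h : P.natDegree ≤ l) : toPoly (ofPoly l P) = P := by
  ext i
  rw [coeff_toPoly]
  split_ifs with hi
  · rfl
  · exact (coeff_eq_zero_of_natDegree_lt (by omega)).symm

theorem toPoly_add {l : ℕ} (u v : PolySpace l) : toPoly (u + v) = toPoly u + toPoly v := by
  simp [toPoly, add_mul, Finset.sum_add_distrib]

theorem toPoly_smul {l : ℕ} (t : ℂ) (u : PolySpace l) : toPoly (t • u) = t • toPoly u := by
  simp [toPoly, Finset.smul_sum, smul_eq_C_mul, mul_assoc]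

theorem toPoly_zero {l : ℕ} : toPoly (0 : PolySpace l) = 0 := by simp [toPoly]

theorem toPoly_neg {l : ℕ} (u : PolySpace l) : toPoly (-u) = -toPoly u := by
  simp [toPoly]

theorem ofPoly_add (l : ℕ) (P Q : ℂ[X]) : ofPoly l (P + Q) = ofPoly l P + ofPoly l Q := by
  ext; simp [ofPoly]

theorem ofPoly_smul (l : ℕ) (t : ℂ) (P : ℂ[X]) : ofPoly l (t • P) = t • ofPoly l P := by
  ext; simp [ofPoly]

/-- Multiplication of polynomials of bounded degree as a bilinear map on coefficient vectors. -/
def mulMap (a b l : ℕ) : PolySpace a →ₗ[ℂ] PolySpace b →ₗ[ℂ] PolySpace l :=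
  LinearMap.mk₂ ℂ (fun u v => ofPoly l (toPoly u * toPoly v))
    (fun u u' v => by rw [toPoly_add, add_mul, ofPoly_add])
    (fun t u v => by rw [toPoly_smul, smul_mul_assoc, ofPoly_smul])
    (fun u v v' => by rw [toPoly_add, mul_add, ofPoly_add])
    (fun t u v => by rw [toPoly_smul, mul_smul_comm, ofPoly_smul])

theorem mulMap_apply {a b l : ℕ} (u : PolySpace a) (v : PolySpace b) :
    mulMap a b l u v = ofPoly l (toPoly u * toPoly v) := rfl

theorem toPoly_mulMap {a b l : ℕ} (h : a + b ≤ l) (u : PolySpace a) (v : PolySpace b) :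
    toPoly (mulMap a b l u v) = toPoly u * toPoly v :=
  toPoly_ofPoly <| natDegree_mul_le.trans <|
    (add_le_add (natDegree_toPoly_le u) (natDegree_toPoly_le v)).trans h

end Coefficients

/-! ### The Jacobian of the GCD equation and its kernel. -/

section Jacobian

theorem withLp_prod_ext {α β : Type*} {x z : WithLp 2 (α × β)} (h1 : x.fst = z.fst)
    (h2 : x.snd = z.snd) : x = z :=
  WithLp.ofLp_injective 2 (Prod.ext h1 h2)

/-- A bilinear map on a finite-dimensional space, as a continuous bilinear map. -/
def continuousBilin {V W : Type*}
    [NormedAddCommGroup V] [InnerProductSpace ℂ V] [FiniteDimensional ℂ V]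
    [NormedAddCommGroup W] [InnerProductSpace ℂ W] (B : V →ₗ[ℂ] V →ₗ[ℂ] W) : V →L[ℂ] V →L[ℂ] W :=
  ((LinearMap.toContinuousLinearMap (𝕜 := ℂ) (E := V) (F' := W)).toLinearMap ∘ₗ
    B).toContinuousLinearMap

variable {m n k : ℕ}

/-- The Jacobian of the GCD equation at `x`, as a bilinear map. -/
def jacLin (m n k : ℕ) : TripleSpace m n k →ₗ[ℂ] TripleSpace m n k →ₗ[ℂ] PairSpace m n :=
  LinearMap.mk₂ ℂ (fun x z => WithLp.toLp 2
      (mulMap k (m - k) m x.fst z.snd.fst + mulMap k (m - k) m z.fst x.snd.fst,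
        mulMap k (n - k) n x.fst z.snd.snd + mulMap k (n - k) n z.fst x.snd.snd))
    (fun x x' z => withLp_prod_ext (by simp; abel) (by simp; abel))
    (fun t x z => withLp_prod_ext (by simp) (by simp))
    (fun x z z' => withLp_prod_ext (by simp; abel) (by simp; abel))
    (fun t x z => withLp_prod_ext (by simp) (by simp))

/-- The Jacobian of the GCD equation at `x`, as a continuous bilinear map. -/
def jacBilin (m n k : ℕ) : TripleSpace m n k →L[ℂ] TripleSpace m n k →L[ℂ] PairSpace m n :=
  continuousBilin (jacLin m n k)

theorem jacBilin_apply (x z : TripleSpace m n k) : jacBilin m n k x z = WithLp.toLp 2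
      (mulMap k (m - k) m x.fst z.snd.fst + mulMap k (m - k) m z.fst x.snd.fst,
        mulMap k (n - k) n x.fst z.snd.snd + mulMap k (n - k) n z.fst x.snd.snd) := rfl

theorem jacBilin_comm (x z : TripleSpace m n k) : jacBilin m n k x z = jacBilin m n k z x := by
  rw [jacBilin_apply, jacBilin_apply]
  congr 2 <;> rw [add_comm]

/-- The involution `(u, v, w) ↦ (u, -v, -w)`, whose value at `x` generates the scalings of the
zero `x` of the GCD equation. -/
def scaleGen (m n k : ℕ) : TripleSpace m n k →ₗᵢ[ℂ] TripleSpace m n k where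
  toFun x := WithLp.toLp 2 (x.fst, -x.snd)
  map_add' x z := withLp_prod_ext (by simp) (by simp; abel)
  map_smul' t x := withLp_prod_ext (by simp) (by simp)
  norm_map' x := by
    rw [← sq_eq_sq₀ (norm_nonneg _) (norm_nonneg _)]
    simp [WithLp.prod_norm_sq_eq_of_L2]

theorem scaleGen_apply (x : TripleSpace m n k) :
    scaleGen m n k x = WithLp.toLp 2 (x.fst, -x.snd) := rfl

theorem scaleGen_scaleGen (x : TripleSpace m n k) : scaleGen m n k (scaleGen m n k x) = x :=
  withLp_prod_ext (by simp [scaleGen_apply]) (by simp [scaleGen_apply])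

theorem jacBilin_scaleGen (x : TripleSpace m n k) :
    jacBilin m n k x (scaleGen m n k x) = 0 := by
  rw [jacBilin_apply, scaleGen_apply]
  simp

theorem gcdMap_zero_iff (hkm : k ≤ m) (hkn : k ≤ n) (x : TripleSpace m n k) (p : PolySpace m)
    (q : PolySpace n) : gcdMap x (WithLp.toLp 2 (p, q)) = 0 ↔
      toPoly x.fst * toPoly x.snd.fst = toPoly p ∧ toPoly x.fst * toPoly x.snd.snd = toPoly q := by
  have h1 := toPoly_mulMap (l := m) (by omega) x.fst x.snd.fst
  have h2 := toPoly_mulMap (l := n) (by omega) x.fst x.snd.snd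
  rw [← h1, ← h2, toPoly_injective.eq_iff, toPoly_injective.eq_iff, gcdMap, ← mulMap_apply,
    ← mulMap_apply]
  rw [← (WithLp.ofLp_injective 2).eq_iff]
  simp [sub_eq_zero]

theorem finrank_tripleSpace (hkm : k ≤ m) (hkn : k ≤ n) :
    Module.finrank ℂ (TripleSpace m n k) = (m + n - k + 2) + 1 := by
  have h1 := (WithLp.linearEquiv 2 ℂ
    (PolySpace k × WithLp 2 (PolySpace (m - k) × PolySpace (n - k)))).finrank_eq
  have h2 := (WithLp.linearEquiv 2 ℂ (PolySpace (m - k) × PolySpace (n - k))).finrank_eq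
  rw [h1, Module.finrank_prod, h2, Module.finrank_prod]
  simp only [finrank_euclideanSpace_fin]
  omega

variable {p : PolySpace m} {q : PolySpace n} {x : TripleSpace m n k}

theorem le_of_natDegree_gcd (hp : (toPoly p).degree = (m : WithBot ℕ))
    (hq : (toPoly q).degree = (n : WithBot ℕ))
    (hk : (EuclideanDomain.gcd (toPoly p) (toPoly q)).natDegree = k) : k ≤ m ∧ k ≤ n := by
  have hp0 : toPoly p ≠ 0 := by rintro h; simp [h] at hp
  have hq0 : toPoly q ≠ 0 := by rintro h; simp [h] at hq
  have h1 := natDegree_le_of_dvd (EuclideanDomain.gcd_dvd_left (toPoly p) (toPoly q)) hp0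
  have h2 := natDegree_le_of_dvd (EuclideanDomain.gcd_dvd_right (toPoly p) (toPoly q)) hq0
  rw [hk, natDegree_eq_of_degree_eq_some hp] at h1
  rw [hk, natDegree_eq_of_degree_eq_some hq] at h2
  exact ⟨h1, h2⟩

/-- The factor `u` divides the GCD, and `deg v ≤ m - k` with `deg p = m` forces `deg u ≥ k`. -/
theorem isGCDTriple_of_gcdMap_eq_zero (hp : (toPoly p).degree = (m : WithBot ℕ))
    (hq : (toPoly q).degree = (n : WithBot ℕ))
    (hk : (EuclideanDomain.gcd (toPoly p) (toPoly q)).natDegree = k)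
    (hx : gcdMap x (WithLp.toLp 2 (p, q)) = 0) : IsGCDTriple x (toPoly p) (toPoly q) := by
  obtain ⟨hkm, hkn⟩ := le_of_natDegree_gcd hp hq hk
  obtain ⟨h1, h2⟩ := (gcdMap_zero_iff hkm hkn x p q).1 hx
  have hp0 : toPoly p ≠ 0 := by rintro h; simp [h] at hp
  have hg0 : EuclideanDomain.gcd (toPoly p) (toPoly q) ≠ 0 := fun h =>
    hp0 (EuclideanDomain.gcd_eq_zero_iff.1 h).1
  refine ⟨?_, h1, h2⟩
  have hdvd : toPoly x.fst ∣ EuclideanDomain.gcd (toPoly p) (toPoly q) :=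
    EuclideanDomain.dvd_gcd ⟨_, h1.symm⟩ ⟨_, h2.symm⟩
  have hu0 : toPoly x.fst ≠ 0 := fun h => hp0 (by rw [← h1, h, zero_mul])
  have hv0 : toPoly x.snd.fst ≠ 0 := fun h => hp0 (by rw [← h1, h, mul_zero])
  have hdeg : k ≤ (toPoly x.fst).natDegree := by
    have := natDegree_mul hu0 hv0
    rw [h1, natDegree_eq_of_degree_eq_some hp] at this
    have := natDegree_toPoly_le x.snd.fst
    omega
  refine associated_of_dvd_of_degree_eq hdvd ?_
  rw [degree_eq_natDegree hu0, degree_eq_natDegree hg0, hk,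
    le_antisymm (natDegree_toPoly_le x.fst) hdeg]

/-- Bézout's identity for the GCD, divided by `u`. -/
theorem isCoprime_of_isGCDTriple {u v w P Q : ℂ[X]} (hP : P ≠ 0)
    (hu : Associated u (EuclideanDomain.gcd P Q)) (hv : u * v = P) (hw : u * w = Q) :
    IsCoprime v w := by
  have hu0 : u ≠ 0 := fun h => hP (by rw [← hv, h, zero_mul])
  have h := EuclideanDomain.gcd_eq_gcd_ab P Q
  obtain ⟨c, hc⟩ := hu.symm
  refine ⟨EuclideanDomain.gcdA P Q * c, EuclideanDomain.gcdB P Q * c, ?_⟩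
  refine mul_left_cancel₀ hu0 ?_
  rw [mul_one]
  conv_rhs => rw [← hc, h, ← hv, ← hw]
  conv_rhs => rw [hv, hw]
  rw [← hv, ← hw]
  ring

/-- At an exact zero of the GCD equation the kernel of the Jacobian is the line tangent to the
scalings. -/
theorem exists_smul_scaleGen_of_jacBilin_eq_zero (hp : (toPoly p).degree = (m : WithBot ℕ))
    (hq : (toPoly q).degree = (n : WithBot ℕ))
    (hk : (EuclideanDomain.gcd (toPoly p) (toPoly q)).natDegree = k)
    (hx : gcdMap x (WithLp.toLp 2 (p, q)) = 0) {z : TripleSpace m n k}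
    (hz : jacBilin m n k x z = 0) : ∃ t : ℂ, z = t • scaleGen m n k x := by
  obtain ⟨hkm, hkn⟩ := le_of_natDegree_gcd hp hq hk
  obtain ⟨hassoc, h1, h2⟩ := isGCDTriple_of_gcdMap_eq_zero hp hq hk hx
  have hp0 : toPoly p ≠ 0 := by rintro h; simp [h] at hp
  have hu0 : toPoly x.fst ≠ 0 := fun h => hp0 (by rw [← h1, h, zero_mul])
  rw [jacBilin_apply, ← (WithLp.ofLp_injective 2).eq_iff] at hz
  have e1 := congrArg toPoly (congrArg Prod.fst hz)
  have e2 := congrArg toPoly (congrArg Prod.snd hz)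
  simp only [WithLp.ofLp_zero, Prod.fst_zero, Prod.snd_zero, toPoly_add, toPoly_zero,
    toPoly_mulMap (show k + (m - k) ≤ m by omega),
    toPoly_mulMap (show k + (n - k) ≤ n by omega)] at e1 e2
  obtain ⟨α, β, hαβ⟩ := isCoprime_of_isGCDTriple hp0 hassoc h1 h2
  -- Multiply `z.fst` by `α v + β w = 1` and use the kernel equations. As `u` has full degree `k`,
  -- the quotient is then a constant.
  have hdvd : toPoly x.fst ∣ toPoly z.fst := by
    refine ⟨-(α * toPoly z.snd.fst + β * toPoly z.snd.snd), ?_⟩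
    linear_combination α * e1 + β * e2 - toPoly z.fst * hαβ
  have hdeg : (toPoly x.fst).natDegree = k := by rw [natDegree_eq_of_degree_eq
    (degree_eq_degree_of_associated hassoc), hk]
  obtain ⟨s, hs⟩ := hdvd
  obtain ⟨t, rfl⟩ : ∃ t, s = C t := by
    rcases eq_or_ne s 0 with rfl | hs0
    · exact ⟨0, by simp⟩
    · have h3 := natDegree_mul hu0 hs0
      rw [← hs, hdeg] at h3
      have h4 := natDegree_toPoly_le z.fst
      exact ⟨_, eq_C_of_natDegree_eq_zero (by omega)⟩
  refine ⟨t, ?_⟩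
  have ha : z.fst = t • x.fst := toPoly_injective (by
    rw [toPoly_smul, hs, smul_eq_C_mul, mul_comm])
  have hb : z.snd.fst = t • -x.snd.fst := toPoly_injective (by
    rw [toPoly_smul, toPoly_neg, smul_eq_C_mul]
    refine mul_left_cancel₀ hu0 ?_
    linear_combination e1 - toPoly x.snd.fst * hs)
  have hc : z.snd.snd = t • -x.snd.snd := toPoly_injective (by
    rw [toPoly_smul, toPoly_neg, smul_eq_C_mul]
    refine mul_left_cancel₀ hu0 ?_
    linear_combination e2 - toPoly x.snd.snd * hs)
  rw [scaleGen_apply]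
  exact withLp_prod_ext ha (withLp_prod_ext hb hc)

end Jacobian

/-! ### The GCD equation as a quadratic map, and the theorem. -/

theorem gcdMap_eq_quadMap {m n k : ℕ} (y : PairSpace m n) :
    (fun z : TripleSpace m n k => gcdMap z y) = quadMap (jacBilin m n k) y := by
  funext z
  have h : (1 / 2 : ℂ) • jacBilin m n k z z = WithLp.toLp 2
      (mulMap k (m - k) m z.fst z.snd.fst, mulMap k (n - k) n z.fst z.snd.snd) := by
    rw [jacBilin_apply, ← WithLp.toLp_smul, Prod.smul_mk, ← two_smul ℂ, ← two_smul ℂ, smul_smul,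
      smul_smul]
    norm_num
  rw [quadMap, h]
  exact withLp_prod_ext rfl rfl

theorem gcdJac_eq {m n k : ℕ} (x : TripleSpace m n k) (y : PairSpace m n) :
    gcdJac x y = jacBilin m n k x := by
  rw [gcdJac, gcdMap_eq_quadMap, fderiv_quadMap jacBilin_comm]

end GCDReg

end

theorem theorem2 :
    -- an absolute constant
    ∃ c : ℝ, 0 < c ∧
    ∀ (m n k : ℕ) (p : PolySpace m) (q : PolySpace n),
      (toPoly p).degree = (m : WithBot ℕ) →
      (toPoly q).degree = (n : WithBot ℕ) →
      (EuclideanDomain.gcd (toPoly p) (toPoly q)).natDegree = k →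
    -- a zero of the mapping at the exact data
    ∀ xhat : TripleSpace m n k, gcdMap xhat (WithLp.toLp 2 (p, q)) = 0 →
    -- how close the data and the initial iterate have to be, and the constants of the
    -- higher order term and of the quadratic rate
    ∃ δ : ℝ, 0 < δ ∧ ∃ ε : ℝ, 0 < ε ∧ ∃ C K : ℝ,
    ∀ y : PairSpace m n, ‖y - WithLp.toLp 2 (p, q)‖ < δ →
    ∀ x₀ : TripleSpace m n k, ‖x₀ - xhat‖ < ε →
      -- the iteration is well defined
      (∀ j : ℕ, ∃! B : TripleSpace m n k →L[ℂ] PairSpace m n,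
        IsRankProj (m + n - k + 2)
          (gcdJac (newtonIter (m + n - k + 2) (fun z => gcdMap z y) x₀ j) y) B) ∧
      -- it converges, and its limit is near an exact GCD triple
      ∃ xtilde : TripleSpace m n k,
        Tendsto (newtonIter (m + n - k + 2) (fun z => gcdMap z y) x₀) atTop (𝓝 xtilde) ∧
        (∃ xcheck : TripleSpace m n k,
          gcdMap xcheck (WithLp.toLp 2 (p, q)) = 0 ∧
          IsGCDTriple xcheck (toPoly p) (toPoly q) ∧
          ‖xtilde - xcheck‖ ≤
            c * gcdCond xhat (WithLp.toLp 2 (p, q)) * ‖y - WithLp.toLp 2 (p, q)‖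
              + C * ‖y - WithLp.toLp 2 (p, q)‖ ^ 2) ∧
        -- at exact data the convergence is quadratic
        (y = WithLp.toLp 2 (p, q) → ∀ j : ℕ,
          ‖newtonIter (m + n - k + 2) (fun z => gcdMap z y) x₀ (j + 1) - xtilde‖ ≤
            K * ‖newtonIter (m + n - k + 2) (fun z => gcdMap z y) x₀ j - xtilde‖ ^ 2) := by
  refine ⟨4, by norm_num, fun m n k p q hp hq hk xhat hxhat => ?_⟩
  obtain ⟨hkm, hkn⟩ := le_of_natDegree_gcd hp hq hk
  have hquad : ∀ (x : TripleSpace m n k) y, gcdMap x y = quadMap (jacBilin m n k) y x :=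
    fun x y => congrFun (gcdMap_eq_quadMap y) x
  have hx0 : xhat ≠ 0 := by
    rintro rfl
    have h := ((gcdMap_zero_iff hkm hkn _ p q).1 hxhat).1
    rw [WithLp.zero_fst, toPoly_zero, zero_mul] at h
    rw [← h, degree_zero] at hp
    exact WithBot.bot_ne_coe hp
  have hker : ∀ z, jacBilin m n k xhat z = 0 → ∃ t : ℂ, z = t • scaleGen m n k xhat := fun z hz =>
    exists_smul_scaleGen_of_jacBilin_eq_zero hp hq hk hxhat hz
  have hzero : quadMap (jacBilin m n k) (WithLp.toLp 2 (p, q)) xhat = 0 :=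
    (hquad _ _).symm.trans hxhat
  obtain ⟨ε, hε0, K, hε⟩ := newtonIter_quadMap_converges jacBilin_comm scaleGen_scaleGen
    jacBilin_scaleGen (finrank_tripleSpace hkm hkn) hx0 hzero hker
  -- The rank at `xhat` is read off from iterate `0` of the iteration started there with exact data.
  have hrk : rk (jacBilin m n k xhat) = m + n - k + 2 :=
    (hε (WithLp.toLp 2 (p, q)) (by simpa using hε0) xhat (by simpa using hε0)).1 0
  -- The error bound is purely linear, so `C = 0`.
  refine ⟨ε, hε0, ε, hε0, 0, K, fun y hy x₀ hx₀ => ?_⟩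
  obtain ⟨hrank, xt, hlim, ⟨c, hc, hdist⟩, hrate⟩ := hε y hy x₀ hx₀
  rw [gcdMap_eq_quadMap]
  refine ⟨fun j => ?_, xt, hlim, ⟨c, (hquad _ _).trans hc,
    isGCDTriple_of_gcdMap_eq_zero hp hq hk ((hquad _ _).trans hc), ?_⟩, hrate⟩
  · rw [gcdJac_eq]
    exact existsUnique_isRankProj (hrank j)
  · rw [gcdCond, gcdJac_eq, rankProj_eq_self hrk, zero_mul, add_zero]
    exact hdist
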